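/- For a finite simple graph $G$, the cummerbund covering number $\mathrm{cc}(G)$ is the number of vertices of $G$ that lie in some longest cycle of $G$. Duplicating a vertex $v$ means adding a new vertex whose neighborhood is $N(v)$. Let $v_1v_2\cdots v_8v_1$ be an $8$-cycle and let $v$ be a further vertex adjacent to exactly $v_1$ and $v_5$. Let $H_1,\dots,H_7$ be the bipartite graphs of order $9$ obtained from this graph by adding, respectively, the following sets of edges: $\emptyset$; $\{v_1v_4\}$; $\{v_1v_4,v_1v_6\}$; $\{v_1v_4,v_2v_5\}$; $\{v_1v_4,v_5v_8\}$; $\{v_1v_4,v_1v_6,v_2v_5\}$; $\{v_1v_4,v_1v_6,v_2v_5,v_5v_8\}$. For $n\ge 9$ let $G_{i,n}$ be the graph of order $n$ obtained from $H_i$ by duplicating the vertex $v$ $n-9$ times (so $G_{i,9}=H_i$), and let $\mathscr{F}_n=\{G_{i,n} : 1\le i\le 7\}$. Theorem. Let $G$ be a $2$-connected bipartite graph of order $n\ge 9$. Then $\mathrm{cc}(G)\ge 8$. Equality holds if and only if $G$ is isomorphic to a member of $\mathscr{F}_n$. -/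

import Mathlib

namespace SimpleGraph

/-- A finite graph is `k`-connected if it has more than `k` vertices and deleting fewer than `k`
vertices always leaves a connected graph. -/
def IsKConnected {V : Type*} [Fintype V] (G : SimpleGraph V) (k : ℕ) : Prop :=
  k < Fintype.card V ∧ ∀ S : Finset V, S.card < k → (G.induce ((S : Set V)ᶜ)).Connected

/-- A cummerbund of `G` is a longest cycle of `G`. -/
def Walk.IsCummerbund {V : Type*} {G : SimpleGraph V} {u : V} (c : G.Walk u u) : Prop :=
  c.IsCycle ∧ ∀ (w : V) (d : G.Walk w w), d.IsCycle → d.length ≤ c.length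

/-- The cummerbund covering number: the number of vertices that lie in a cummerbund. -/
noncomputable def cummerbundCoveringNumber {V : Type*} (G : SimpleGraph V) : ℕ :=
  {x : V | ∃ (u : V) (c : G.Walk u u), c.IsCummerbund ∧ x ∈ c.support}.ncard

/-- Duplicating the vertex `v` of a graph on `Fin m`. The old vertices are embedded by
`Fin.castSucc`, the new vertex is `Fin.last m`, and two vertices are adjacent iff they are so after
the new vertex has been replaced by `v`. So adjacency of old vertices is unchanged, and the
neighbourhood of the new vertex is that of `v`. -/
def duplicate {m : ℕ} (G : SimpleGraph (Fin m)) (v : Fin m) : SimpleGraph (Fin (m + 1)) :=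
  G.comap (Fin.lastCases v id)

end SimpleGraph

/-- The chords of the 8-cycle `0 1 2 3 4 5 6 7` in each of the seven graphs of order 9. -/
def extremalChords : Fin 7 → List (Fin 9 × Fin 9) :=
  ![[],
    [(0, 3)],
    [(0, 3), (0, 5)],
    [(0, 3), (1, 4)],
    [(0, 3), (4, 7)],
    [(0, 3), (0, 5), (1, 4)],
    [(0, 3), (0, 5), (1, 4), (4, 7)]]

/-- The seven graphs of order 9: an 8-cycle `0 1 2 3 4 5 6 7`, a further vertex `8` whose
neighbours are the antipodal vertices `0` and `4` of the cycle, and the chords listed above. -/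
def extremalBase (i : Fin 7) : SimpleGraph (Fin 9) :=
  SimpleGraph.fromRel fun a b => (a, b) ∈
    [(0, 1), (1, 2), (2, 3), (3, 4), (4, 5), (5, 6), (6, 7), (7, 0), (8, 0), (8, 4)]
      ++ extremalChords i

/-- `extremalGraph i k` is the graph of order `9 + k` obtained from `extremalBase i` by
duplicating the vertex `8` (the vertex outside the 8-cycle) `k` times. -/
def extremalGraph (i : Fin 7) : (k : ℕ) → SimpleGraph (Fin (9 + k))
  | 0 => extremalBase i
  | k + 1 => (extremalGraph i k).duplicate (Fin.castAdd k 8)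

/-! Let `C` be a longest cycle. By 2-connectivity every vertex off `C` lies on an ear of `C`, and
the two ends of the ear cut `C` into arcs with `A` and `B` inner vertices. If the ear has `l ≥ 1`
inner vertices, replacing an arc by it gives another cycle, so maximality yields `l ≤ A` and `l ≤
B`, and bipartiteness yields `l ≡ A` mod 2. If `l = A` or `l = B`, the ear lies in a longest cycle
(`IsCummerbundList.arcs_of_isEar`). When `|C| ≤ 6`, so that `A + B ≤ 4`, this equality is forced:
all `n ≥ 9` vertices are covered. Otherwise the eight or more vertices of `C` are. This is the lower
bound.

If exactly 8 vertices are covered, then `|C| = 8` and all longest cycles have the vertex set of `C`,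
so every ear has `l = 1` and `A = B = 3` (`exists_isTightCycle`). Hence each outside vertex is
adjacent to exactly one antipodal pair of `C`. All outside vertices share the pair, say `f 0` and `f
4`, since two different pairs would give a cycle of length at least 8 leaving `C`. The same ban
excludes the four bipartite chords that miss both `f 0` and `f 4`. The sixteen subsets of the other
four chords fall, up to the symmetries of the 8-cycle that preserve the pair, into the seven listed
graphs.

Conversely, in an extremal graph a cycle through an outside vertex passes through `f 0` and `f 4`,
and the rest of it lies in one component of what remains, which has at most 3 vertices. Its length
is at most 6, so it is not longest. -/

namespace SimpleGraph

variable {V : Type*} {G : SimpleGraph V}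

/-! ### Cycles as vertex lists. -/

/-- A list of vertices that traverses a cycle of `G`, every vertex of it once. -/
def IsCycleList (G : SimpleGraph V) (l : List V) : Prop :=
  3 ≤ l.length ∧ l.Nodup ∧ (l : Cycle V).Chain G.Adj

theorem isCycleList_cons {a : V} {l : List V} :
    G.IsCycleList (a :: l) ↔ 2 ≤ l.length ∧ (a :: l).Nodup ∧ (a :: (l ++ [a])).IsChain G.Adj := by
  simp [IsCycleList, Cycle.chain_coe_cons]

theorem IsCycleList.isRotated {l l' : List V} (h : G.IsCycleList l) (hl : l ~r l') :
    G.IsCycleList l' := by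
  refine ⟨hl.perm.length_eq ▸ h.1, hl.perm.nodup_iff.1 h.2.1, ?_⟩
  rw [← Cycle.coe_eq_coe.2 hl]
  exact h.2.2

theorem exists_walk_of_isChain {a : V} {l : List V} (h : (a :: l).IsChain G.Adj) :
    ∃ (b : V) (p : G.Walk a b), p.support = a :: l := by
  induction l generalizing a with
  | nil => exact ⟨a, .nil, rfl⟩
  | cons c l ih =>
    obtain ⟨b, p, hp⟩ := ih h.of_cons
    exact ⟨b, .cons h.rel p, by simp [hp]⟩

theorem IsCycleList.exists_walk {l : List V} (h : G.IsCycleList l) :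
    ∃ (u : V) (c : G.Walk u u), c.IsCycle ∧ c.length = l.length ∧ ∀ x, x ∈ c.support ↔ x ∈ l := by
  obtain _ | ⟨a, l⟩ := l
  · simp [IsCycleList] at h
  rw [isCycleList_cons] at h
  obtain ⟨b, p, hp⟩ := exists_walk_of_isChain h.2.2
  have hb : b = a := by
    have := p.getLast_support
    simpa [hp] using this.symm
  subst hb
  have hlen : p.length + 1 = l.length + 2 := by
    rw [← Walk.length_support, hp]; simp
  refine ⟨b, p, ?_, by simp at hlen ⊢; omega, fun x => ?_⟩
  · rw [Walk.isCycle_iff_isPath_tail_and_le_length]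
    refine ⟨?_, by omega⟩
    rw [Walk.isPath_def, Walk.support_tail_of_not_nil, hp]
    · have := h.2.1
      simp only [List.tail_cons]
      rw [List.nodup_append_comm]
      simpa using this
    · exact Walk.not_nil_iff_lt_length.2 (by omega)
  · rw [hp]; simp; tauto

theorem Walk.IsCycle.exists_isCycleList {u : V} {c : G.Walk u u} (h : c.IsCycle) :
    ∃ l : List V, G.IsCycleList l ∧ c.length = l.length ∧ ∀ x, x ∈ c.support ↔ x ∈ l := by
  have h3 := h.three_le_length
  have hch := c.isChain_adj_support
  have hnd := h.support_nodup
  have hlen := c.length_support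
  have hs : c.support = u :: c.support.tail := by simp
  have hne : c.support.tail ≠ [] := by
    intro h0
    have := congrArg List.length h0
    rw [List.length_tail, hlen, List.length_nil] at this
    omega
  have hlast : c.support.tail.getLast hne = u := by
    rw [List.getLast_tail]; exact c.getLast_support
  have htail : c.support.tail = c.support.tail.dropLast ++ [u] := by
    conv_lhs => rw [← List.dropLast_append_getLast hne, hlast]
  generalize c.support.tail.dropLast = m at htail
  rw [htail] at hnd
  rw [hs, htail] at hlen hch
  refine ⟨u :: m, ?_, ?_, ?_⟩
  · rw [isCycleList_cons]
    refine ⟨by simp at hlen; omega, ?_, hch⟩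
    rw [List.nodup_append_comm] at hnd
    simpa using hnd
  · simp at hlen ⊢; omega
  · intro x; rw [hs, htail]; simp; tauto

/-- A longest cycle, given by a list. -/
def IsCummerbundList (G : SimpleGraph V) (l : List V) : Prop :=
  G.IsCycleList l ∧ ∀ m, G.IsCycleList m → m.length ≤ l.length

/-- Passes from closed walks to lists, which are easier to rotate, cut and splice. -/
theorem mem_cummerbund_iff {x : V} :
    (∃ (u : V) (c : G.Walk u u), c.IsCummerbund ∧ x ∈ c.support) ↔
      ∃ l, G.IsCummerbundList l ∧ x ∈ l := by
  constructor
  · rintro ⟨u, c, ⟨hc, hmax⟩, hx⟩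
    obtain ⟨l, hl, hlen, hmem⟩ := hc.exists_isCycleList
    refine ⟨l, ⟨hl, fun m hm => ?_⟩, (hmem x).1 hx⟩
    obtain ⟨w, d, hd, hdl, -⟩ := hm.exists_walk
    rw [← hdl, ← hlen]
    exact hmax w d hd
  · rintro ⟨l, ⟨hl, hmax⟩, hx⟩
    obtain ⟨u, c, hc, hlen, hmem⟩ := hl.exists_walk
    refine ⟨u, c, ⟨hc, fun w d hd => ?_⟩, (hmem x).2 hx⟩
    obtain ⟨m, hm, hml, -⟩ := hd.exists_isCycleList
    rw [hml, hlen]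
    exact hmax m hm

theorem cummerbundCoveringNumber_eq :
    G.cummerbundCoveringNumber = {x : V | ∃ l, G.IsCummerbundList l ∧ x ∈ l}.ncard := by
  simp only [cummerbundCoveringNumber, mem_cummerbund_iff]

theorem IsCycleList.even_length {l : List V} (h : G.IsCycleList l) (hG : G.IsBipartite) :
    Even l.length := by
  obtain ⟨u, c, -, hlen, -⟩ := h.exists_walk
  rw [← hlen]
  exact two_colorable_iff_forall_loop_even.1 hG u c

/-! ### Fans and ears in 2-connected graphs. -/

/-- An ear of the vertex set `S`: a path with distinct ends `a`, `b` in `S` whose list `l` of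
inner vertices avoids `S`. -/
def IsEar (G : SimpleGraph V) (S : Set V) (a : V) (l : List V) (b : V) : Prop :=
  a ∈ S ∧ b ∈ S ∧ (∀ y ∈ l, y ∉ S) ∧ (a :: (l ++ [b])).Nodup ∧ (a :: (l ++ [b])).IsChain G.Adj

/-- Two paths from `x` to distinct vertices `a`, `b` of `S` that share only `x` and otherwise avoid
`S`. -/
def IsFan (G : SimpleGraph V) (S : Set V) (x : V) (P : List V) (a : V) (Q : List V) (b : V) :
    Prop :=
  a ∈ S ∧ b ∈ S ∧ (∀ y ∈ P, y ∉ S) ∧ (∀ y ∈ Q, y ∉ S) ∧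
    (x :: (P ++ [a])).IsChain G.Adj ∧ (x :: (Q ++ [b])).IsChain G.Adj ∧
    (x :: (P ++ [a]) ++ (Q ++ [b])).Nodup

theorem IsFan.symm {S : Set V} {x a b : V} {P Q : List V} (h : G.IsFan S x P a Q b) :
    G.IsFan S x Q b P a := by
  obtain ⟨h1, h2, h3, h4, h5, h6, h7⟩ := h
  refine ⟨h2, h1, h4, h3, h6, h5, h7.perm ?_⟩
  simp only [List.cons_append]
  exact List.Perm.cons _ List.perm_append_comm

/-- A path from `x` to a set, stopped at its first vertex in the set. -/
theorem exists_path_to_set (hG : ∀ z : V, (G.induce ({z}ᶜ : Set V)).Connected) {x z t : V}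
    {T : Set V} (hxz : x ≠ z) (ht : t ∈ T) (htz : t ≠ z) :
    ∃ (L : List V) (r : V), r ∈ T ∧ r ≠ z ∧ (L ++ [r]).IsChain G.Adj ∧ (L ++ [r]).Nodup ∧
      (L ++ [r]).head? = some x ∧ ∀ y ∈ L, y ∉ T ∧ y ≠ z := by
  classical
  obtain ⟨p, hp⟩ := ((hG z).preconnected ⟨x, hxz⟩ ⟨t, htz⟩).exists_isPath
  have key : ∀ l : List V, (∃ t ∈ l, t ∈ T) → ∃ (L : List V) (r : V) (M : List V),
      l = L ++ r :: M ∧ r ∈ T ∧ ∀ y ∈ L, y ∉ T := by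
    intro l
    induction l with
    | nil => simp
    | cons c l ih =>
      intro h
      by_cases hc : c ∈ T
      · exact ⟨[], c, l, rfl, hc, by simp⟩
      · obtain ⟨L, r, M, h1, h2, h3⟩ := ih (by
          obtain ⟨t, h1, h2⟩ := h
          rcases List.mem_cons.1 h1 with rfl | h1
          · exact absurd h2 hc
          · exact ⟨t, h1, h2⟩)
        refine ⟨c :: L, r, M, by simp [h1], h2, ?_⟩
        simpa [hc] using h3
  obtain ⟨L, r, M, h1, h2, h3⟩ := key (p.support.map Subtype.val)
    ⟨t, List.mem_map.2 ⟨_, p.end_mem_support, rfl⟩, ht⟩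
  have hz : ∀ y ∈ p.support.map Subtype.val, y ≠ z := by
    intro y hy
    obtain ⟨w, -, rfl⟩ := List.mem_map.1 hy
    exact w.2
  have hch : (p.support.map Subtype.val).IsChain G.Adj := by
    rw [List.isChain_map]
    exact p.isChain_adj_support.imp fun a b h => h
  have hnd : (p.support.map Subtype.val).Nodup := hp.support_nodup.map Subtype.val_injective
  have hhd : (p.support.map Subtype.val).head? = some x := by
    rw [← Walk.cons_tail_support]; rfl
  rw [h1] at hz hch hnd hhd
  have e : L ++ r :: M = (L ++ [r]) ++ M := by simp
  rw [e] at hch hnd hhd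
  refine ⟨L, r, h2, hz r (by simp), hch.left_of_append, hnd.of_append_left, ?_,
    fun y hy => ⟨h3 y hy, hz y (by simp [hy])⟩⟩
  rw [← hhd]
  cases L <;> simp

/-- Inductive step of the fan lemma: a fan moves from `x'` to its neighbour `x`. A path from `x`
that avoids `x'` is followed until it first meets `S` or the old fan. It supplies one branch, and
the edge to `x'` followed by an untouched old branch supplies the other. -/
theorem exists_isFan_of_adj (hG : ∀ z : V, (G.induce ({z}ᶜ : Set V)).Connected) {S : Set V}
    (hS : S.Nontrivial) {x x' : V} (hadj : G.Adj x x') (hx : x ∉ S)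
    (ih : x' ∈ S ∨ ∃ P a Q b, G.IsFan S x' P a Q b) : ∃ P a Q b, G.IsFan S x P a Q b := by
  by_cases hx' : x' ∈ S
  · obtain ⟨t, ht, htx⟩ := hS.exists_ne x'
    obtain ⟨L, r, hr, hrx, hch, hnd, hhd, hL⟩ := exists_path_to_set hG hadj.ne ht htx
    obtain _ | ⟨c, L⟩ := L
    · simp at hhd; subst hhd; exact absurd hr hx
    · simp at hhd; subst hhd
      refine ⟨[], x', L, r, hx', hr, by simp, fun y hy => (hL y (by simp [hy])).1,
        by simpa using hadj, hch, ?_⟩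
      have h1 : x' ∉ c :: L := fun h => (hL x' h).2 rfl
      have hne := hadj.ne
      clear hL hch ih
      simp only [List.nodup_append, List.nodup_cons, List.mem_append, List.mem_cons,
        List.cons_append, List.nil_append] at *
      grind
  · obtain ⟨P, a, Q, b, hF⟩ := ih.resolve_left hx'
    -- the case of a path that meets the fan in its first branch
    have branch : ∀ {P a Q b}, G.IsFan S x' P a Q b → ∀ {L r}, r ∈ P → r ≠ x' →
        (L ++ [r]).IsChain G.Adj → (L ++ [r]).Nodup → (L ++ [r]).head? = some x →
        (∀ y ∈ L, (y ∉ S ∧ y ∉ P ∧ y ∉ Q) ∧ y ≠ x') → ∃ P a Q b, G.IsFan S x P a Q b := by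
      intro P a Q b ⟨h1, h2, h3, h4, h5, h6, h7⟩ L r hr hrx hch hnd hhd hL
      obtain ⟨P₁, P₂, rfl⟩ := List.append_of_mem hr
      have hch2 : (r :: (P₂ ++ [a])).IsChain G.Adj := by
        have : x' :: (P₁ ++ r :: P₂ ++ [a]) = (x' :: P₁) ++ (r :: (P₂ ++ [a])) := by simp
        rw [this] at h5
        exact h5.right_of_append
      have hxQ : (x :: (x' :: Q ++ [b])).IsChain G.Adj := by
        simpa using ⟨hadj, by simpa using h6⟩
      have hne := hadj.ne
      -- If `L` is empty, `x` itself lies on the branch `P`, and the rest of `P` serves as its first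
      -- branch.
      obtain _ | ⟨c, L⟩ := L
      · simp at hhd; subst hhd
        refine ⟨P₂, a, x' :: Q, b, h1, h2, fun y hy => h3 y (by simp [hy]), ?_, hch2, hxQ, ?_⟩
        · simpa [hx'] using h4
        · clear hL h3 h4 h5 h6 hch hch2 hxQ
          simp only [List.nodup_append, List.nodup_cons, List.mem_append, List.mem_cons,
            List.cons_append] at *
          grind
      · simp at hhd; subst hhd
        refine ⟨L ++ r :: P₂, a, x' :: Q, b, h1, h2, ?_, ?_, ?_, hxQ, ?_⟩
        · intro y hy
          simp only [List.mem_append, List.mem_cons] at hy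
          rcases hy with hy | rfl | hy
          · exact (hL y (by simp [hy])).1.1
          · exact h3 _ (by simp)
          · exact h3 y (by simp [hy])
        · simpa [hx'] using h4
        · have e : c :: (L ++ r :: P₂ ++ [a]) = (c :: L) ++ r :: (P₂ ++ [a]) := by simp
          rw [e, List.isChain_split]
          exact ⟨hch, hch2⟩
        · have haL : a ∉ c :: L := fun h => (hL a h).1.1 h1
          have hbL : b ∉ c :: L := fun h => (hL b h).1.1 h2
          have hd : ∀ y ∈ c :: L, y ∉ P₁ ++ r :: P₂ ∧ y ∉ Q ∧ y ≠ x' := fun y hy =>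
            ⟨(hL y hy).1.2.1, (hL y hy).1.2.2, (hL y hy).2⟩
          clear hL h3 h4 h5 h6 hch hch2 hxQ
          have hd' := hd c (by simp)
          simp only [List.nodup_append, List.nodup_cons, List.mem_append, List.mem_cons,
            List.cons_append] at *
          grind
    obtain ⟨L, r, hr, hrx, hch, hnd, hhd, hL⟩ := exists_path_to_set hG (x := x) (z := x') (t := a)
      (T := {y | y ∈ S ∨ y ∈ P ∨ y ∈ Q}) hadj.ne (.inl hF.1) (fun h => hx' (h ▸ hF.1))
    simp only [Set.mem_ofPred_eq, not_or] at hr hL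
    rcases hr with hr | hr | hr
    · -- the case of a path that meets `S` first
      have toSet : ∀ {P a Q b}, G.IsFan S x' P a Q b → r ≠ b →
          (∀ y ∈ L, (y ∉ S ∧ y ∉ P ∧ y ∉ Q) ∧ y ≠ x') → ∃ P a Q b, G.IsFan S x P a Q b := by
        intro P a Q b ⟨h1, h2, h3, h4, h5, h6, h7⟩ hrb hL
        obtain _ | ⟨c, L⟩ := L
        · simp at hhd; subst hhd; exact absurd hr hx
        · simp at hhd; subst hhd
          have hxQ : (c :: (x' :: Q ++ [b])).IsChain G.Adj := by
            simpa using ⟨hadj, by simpa using h6⟩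
          refine ⟨L, r, x' :: Q, b, hr, h2, fun y hy => (hL y (by simp [hy])).1.1, ?_, hch, hxQ, ?_⟩
          · simpa [hx'] using h4
          · have hbL : b ∉ c :: L := fun h => (hL b h).1.1 h2
            have hd : ∀ y ∈ c :: L, y ∉ Q ∧ y ≠ x' := fun y hy =>
              ⟨(hL y hy).1.2.2, (hL y hy).2⟩
            have hrQ : r ∉ Q := fun h => h4 r h hr
            clear hL h3 h4 h5 h6 hch hxQ
            have hd' := hd c (by simp)
            simp only [List.nodup_append, List.nodup_cons, List.mem_append, List.mem_cons,
              List.cons_append] at *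
            grind
      -- The old branch that is kept must not end in `r`. As `a ≠ b`, one of the two qualifies.
      by_cases hrb : r = b
      · refine toSet hF.symm ?_ fun y hy => ⟨⟨(hL y hy).1.1, (hL y hy).1.2.2, (hL y hy).1.2.1⟩,
          (hL y hy).2⟩
        rintro rfl
        have := hF.2.2.2.2.2.2
        simp [hrb, List.nodup_append] at this
      · exact toSet hF hrb hL
    · exact branch hF hr hrx hch hnd hhd hL
    · exact branch hF.symm hr hrx hch hnd hhd fun y hy =>
        ⟨⟨(hL y hy).1.1, (hL y hy).1.2.2, (hL y hy).1.2.1⟩, (hL y hy).2⟩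

theorem exists_isFan (hG : ∀ z : V, (G.induce ({z}ᶜ : Set V)).Connected) (hc : G.Preconnected)
    {S : Set V} (hS : S.Nontrivial) {x : V} (hx : x ∉ S) : ∃ P a Q b, G.IsFan S x P a Q b := by
  have key : ∀ {u s : V}, G.Walk u s → s ∈ S → u ∈ S ∨ ∃ P a Q b, G.IsFan S u P a Q b := by
    intro u s p hs
    induction p with
    | nil => exact .inl hs
    | @cons u v w h p ih =>
      by_cases hu : u ∈ S
      · exact .inl hu
      · exact .inr (exists_isFan_of_adj hG hS h hu (ih hs))
  obtain ⟨s, hs⟩ := hS.nonempty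
  obtain ⟨p⟩ := hc x s
  exact (key p hs).resolve_left hx

/-- The two branches of a fan at `x`, joined at `x`, form an ear. -/
theorem exists_isEar (hG : ∀ z : V, (G.induce ({z}ᶜ : Set V)).Connected) (hc : G.Preconnected)
    {S : Set V} (hS : S.Nontrivial) {x : V} (hx : x ∉ S) :
    ∃ a l b, G.IsEar S a l b ∧ x ∈ l := by
  obtain ⟨P, a, Q, b, h1, h2, h3, h4, h5, h6, h7⟩ := exists_isFan hG hc hS hx
  refine ⟨a, P.reverse ++ x :: Q, b, ⟨h1, h2, ?_, ?_, ?_⟩, by simp⟩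
  · intro y hy
    simp only [List.mem_append, List.mem_reverse, List.mem_cons] at hy
    rcases hy with hy | rfl | hy
    · exact h3 y hy
    · exact hx
    · exact h4 y hy
  · refine h7.perm ?_
    have : a :: (P.reverse ++ x :: Q ++ [b]) = (x :: (P ++ [a])).reverse ++ (Q ++ [b]) := by simp
    rw [this]
    exact (List.reverse_perm _).symm.append_right _
  · have : a :: (P.reverse ++ x :: Q ++ [b]) = (a :: P.reverse) ++ x :: (Q ++ [b]) := by simp
    rw [this, List.isChain_split]
    refine ⟨?_, h6⟩
    have e : a :: P.reverse ++ [x] = (x :: (P ++ [a])).reverse := by simp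
    rw [e, List.isChain_reverse]
    exact h5.imp fun _ _ h => h.symm

/-! ### Exchanging an arc of a cycle for an ear. -/

theorem IsCycleList.exchange_left {a b : V} {A B l : List V}
    (h : G.IsCycleList (a :: (A ++ b :: B)))
    (he : G.IsEar {x | x ∈ a :: (A ++ b :: B)} a l b) (hl : l ≠ []) :
    G.IsCycleList (a :: (l ++ b :: B)) := by
  obtain ⟨-, -, hav, hnd, hch⟩ := he
  rw [isCycleList_cons] at h ⊢
  obtain ⟨-, hn, hc⟩ := h
  have hlen := List.length_pos_iff.2 hl
  refine ⟨by simp; omega, ?_, ?_⟩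
  · simp only [Set.mem_ofPred_eq] at hav
    clear hc hch
    simp only [List.nodup_append, List.nodup_cons, List.mem_append, List.mem_cons] at *
    grind
  · have e : ∀ L : List V, a :: (L ++ b :: B ++ [a]) = (a :: L) ++ b :: (B ++ [a]) := by simp
    rw [e, List.isChain_split] at hc ⊢
    exact ⟨by simpa using hch, hc.2⟩

theorem IsCycleList.exchange_right {a b : V} {A B l : List V}
    (h : G.IsCycleList (a :: (A ++ b :: B)))
    (he : G.IsEar {x | x ∈ a :: (A ++ b :: B)} a l b) (hl : l ≠ []) :
    G.IsCycleList (a :: (A ++ b :: l.reverse)) := by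
  obtain ⟨-, -, hav, hnd, hch⟩ := he
  rw [isCycleList_cons] at h ⊢
  obtain ⟨-, hn, hc⟩ := h
  have hlen := List.length_pos_iff.2 hl
  refine ⟨by simp; omega, ?_, ?_⟩
  · have hp : (a :: (A ++ b :: l.reverse)).Perm (a :: (A ++ b :: l)) :=
      .cons _ (.append_left _ (.cons _ (List.reverse_perm l)))
    rw [hp.nodup_iff]
    simp only [Set.mem_ofPred_eq] at hav
    clear hc hch hp
    simp only [List.nodup_append, List.nodup_cons, List.mem_append, List.mem_cons] at *
    grind
  · have e : ∀ L : List V, a :: (A ++ b :: L ++ [a]) = (a :: A) ++ b :: (L ++ [a]) := by simp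
    rw [e, List.isChain_split] at hc ⊢
    refine ⟨hc.1, ?_⟩
    have e' : b :: (l.reverse ++ [a]) = (a :: (l ++ [b])).reverse := by simp
    rw [e', List.isChain_reverse]
    exact hch.imp fun _ _ h => h.symm

theorem exists_isRotated_of_mem {C : List V} {a b : V} (ha : a ∈ C) (hb : b ∈ C) (hab : a ≠ b) :
    ∃ A B, C ~r a :: (A ++ b :: B) := by
  obtain ⟨C₁, C₂, rfl⟩ := List.append_of_mem ha
  have hr : (C₁ ++ a :: C₂) ~r (a :: (C₂ ++ C₁)) := by
    simpa using List.isRotated_append (l := C₁) (l' := a :: C₂)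
  have hb' : b ∈ C₂ ++ C₁ := by
    simp only [List.mem_append, List.mem_cons] at hb ⊢
    grind
  obtain ⟨A, B, hAB⟩ := List.append_of_mem hb'
  exact ⟨A, B, hAB ▸ hr⟩

/-- An ear of a longest cycle of a bipartite graph is no longer than either of the two arcs between
its ends, of the same parity, and lies in a longest cycle if it is as long as one of the arcs. -/
theorem IsCummerbundList.arcs_of_isEar (hG : G.IsBipartite) {C : List V}
    (hC : G.IsCummerbundList C) {a b : V} {l : List V} (he : G.IsEar {x | x ∈ C} a l b)
    (hl : l ≠ []) :
    ∃ A B, C ~r a :: (A ++ b :: B) ∧ C.length = A.length + B.length + 2 ∧ Even C.length ∧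
      l.length ≤ A.length ∧ l.length ≤ B.length ∧ l.length % 2 = A.length % 2 ∧
      (l.length = A.length ∨ l.length = B.length →
        ∀ x ∈ l, ∃ D, G.IsCummerbundList D ∧ x ∈ D) := by
  have hab : a ≠ b := by
    have := he.2.2.2.1
    simp only [List.nodup_cons, List.mem_append] at this
    grind
  obtain ⟨A, B, hr⟩ := exists_isRotated_of_mem he.1 he.2.1 hab
  have hcyc := hC.1.isRotated hr
  have hlen : C.length = A.length + B.length + 2 := by
    rw [hr.perm.length_eq]; simp; omega
  have he' : G.IsEar {x | x ∈ a :: (A ++ b :: B)} a l b := by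
    convert he using 3 with x
    exact hr.mem_iff.symm
  have h₁ := hcyc.exchange_left he' hl
  have h₂ := hcyc.exchange_right he' hl
  have l₁ := hC.2 _ h₁
  have l₂ := hC.2 _ h₂
  have e₀ := hC.1.even_length hG
  have e₁ := h₁.even_length hG
  simp only [List.length_cons, List.length_append, List.length_reverse] at l₁ l₂ e₁
  refine ⟨A, B, hr, hlen, e₀, by omega, by omega, ?_, ?_⟩
  · rw [hlen] at e₀
    rw [Nat.even_iff] at e₀ e₁
    omega
  · rintro (h | h) x hx
    · refine ⟨_, ⟨h₁, fun m hm => (hC.2 m hm).trans ?_⟩, by simp [hx]⟩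
      simp; omega
    · refine ⟨_, ⟨h₂, fun m hm => (hC.2 m hm).trans ?_⟩, by simp [hx]⟩
      simp; omega

/-! ### Existence of longest cycles and the lower bound. -/

theorem IsKConnected.connected_induce_compl_singleton [Fintype V] (h : G.IsKConnected 2) (z : V) :
    (G.induce ({z}ᶜ : Set V)).Connected := by
  have := h.2 {z} (by simp)
  rwa [Finset.coe_singleton] at this

theorem IsKConnected.connected [Fintype V] (h : G.IsKConnected 2) : G.Connected := by
  have := h.2 ∅ (by simp)
  rw [Finset.coe_empty, Set.compl_empty] at this
  exact (induceUnivIso G).connected_iff.1 this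

/-- An ear of the two ends of an edge, taken through a third vertex, is closed to a cycle by that
edge. -/
theorem IsKConnected.exists_isCycleList [Fintype V] (h : G.IsKConnected 2) :
    ∃ l, G.IsCycleList l := by
  classical
  have hc := h.connected
  have hcard := h.1
  have : Nontrivial V := Fintype.one_lt_card_iff_nontrivial.1 (by omega)
  obtain ⟨u⟩ := hc.nonempty
  obtain ⟨w, hw⟩ := hc.preconnected.exists_adj_of_nontrivial u
  obtain ⟨x, hx⟩ : ∃ x, x ∉ ({u, w} : Finset V) := by
    by_contra! hcon
    have := Finset.card_le_card (fun x _ => hcon x : (Finset.univ : Finset V) ⊆ {u, w})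
    have := Finset.card_le_two (a := u) (b := w)
    rw [Finset.card_univ] at *
    omega
  obtain ⟨a, l, b, ⟨ha, hb, -, hnd, hch⟩, hxl⟩ :=
    exists_isEar (S := {u, w}) h.connected_induce_compl_singleton hc.preconnected
      (Set.nontrivial_pair hw.ne) (x := x) (by simpa using hx)
  have hba : G.Adj b a := by
    have hab : a ≠ b := by
      simp only [List.nodup_cons, List.mem_append] at hnd
      grind
    rcases ha with rfl | rfl <;> rcases hb with rfl | rfl
    · exact absurd rfl hab
    · exact hw.symm
    · exact hw
    · exact absurd rfl hab
  refine ⟨a :: (l ++ [b]), isCycleList_cons.2 ⟨?_, hnd, ?_⟩⟩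
  · have := List.length_pos_of_mem hxl
    simp; omega
  · have e : a :: (l ++ [b] ++ [a]) = (a :: l) ++ b :: [a] := by simp
    rw [e, List.isChain_split]
    exact ⟨by simpa using hch, by simpa using hba⟩

theorem IsKConnected.exists_isCummerbundList [Fintype V] (h : G.IsKConnected 2) :
    ∃ l, G.IsCummerbundList l := by
  classical
  obtain ⟨l₀, h₀⟩ := h.exists_isCycleList
  have hfin : {k | ∃ l, G.IsCycleList l ∧ l.length = k}.Finite := by
    refine (Set.finite_Iic (Fintype.card V)).subset ?_
    rintro _ ⟨l, hl, rfl⟩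
    exact hl.2.1.length_le_card
  obtain ⟨k, ⟨l, hl, rfl⟩, hmax⟩ := hfin.exists_maximal ⟨_, l₀, h₀, rfl⟩
  refine ⟨l, hl, fun m hm => ?_⟩
  by_contra! hlt
  have := hmax ⟨m, hm, rfl⟩ hlt.le
  omega

theorem IsCummerbundList.length_le_cummerbundCoveringNumber [Finite V] {C : List V}
    (hC : G.IsCummerbundList C) : C.length ≤ G.cummerbundCoveringNumber := by
  classical
  rw [cummerbundCoveringNumber_eq, ← List.toFinset_card_of_nodup hC.1.2.1,
    ← Set.ncard_coe_finset]
  exact Set.ncard_le_ncard (fun x hx => ⟨C, hC, by simpa using hx⟩) (Set.toFinite _)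

theorem IsCycleList.nontrivial {C : List V} (hC : G.IsCycleList C) :
    {x | x ∈ C}.Nontrivial := by
  obtain _ | ⟨a, _ | ⟨b, l⟩⟩ := C
  · simp [IsCycleList] at hC
  · simp [IsCycleList] at hC
  · refine ⟨a, by simp, b, by simp, ?_⟩
    have := hC.2.1
    simp only [List.nodup_cons, List.mem_cons] at this
    tauto

/-- Every vertex lies in a longest cycle if these have length at most 6. -/
theorem IsCummerbundList.cummerbundCoveringNumber_of_length_lt [Fintype V]
    (h : G.IsKConnected 2) (hG : G.IsBipartite) {C : List V} (hC : G.IsCummerbundList C)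
    (hlt : C.length < 8) : G.cummerbundCoveringNumber = Fintype.card V := by
  rw [cummerbundCoveringNumber_eq, ← Nat.card_eq_fintype_card, ← Set.ncard_univ]
  congr 1
  refine Set.eq_univ_of_forall fun x => ?_
  by_cases hx : x ∈ C
  · exact ⟨C, hC, hx⟩
  obtain ⟨a, l, b, he, hxl⟩ := exists_isEar h.connected_induce_compl_singleton
    h.connected.preconnected hC.1.nontrivial (x := x) hx
  have hl : l ≠ [] := List.ne_nil_of_mem hxl
  have hpos := List.length_pos_iff.2 hl
  obtain ⟨A, B, -, h1, h2, h3, h4, h5, h6⟩ := hC.arcs_of_isEar hG he hl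
  rw [Nat.even_iff] at h2
  -- The arcs have at most 4 inner vertices together, so a nonempty ear no longer than either and of
  -- their parity has the length of one of them.
  exact h6 (by omega) x hxl

/-! ### Recognising the extremal graphs. -/

/-- The vertex of `extremalBase i` of which a vertex of `extremalGraph i k` is a copy. -/
def extremalProj (k : ℕ) (a : Fin (9 + k)) : Fin 9 := ⟨min a 8, by omega⟩

/-- Iterated duplication amounts to one pullback, because each new vertex projects to 8 as the
duplicated one does. -/
theorem extremalGraph_adj (i : Fin 7) (k : ℕ) (a b : Fin (9 + k)) :
    (extremalGraph i k).Adj a b ↔ (extremalBase i).Adj (extremalProj k a) (extremalProj k b) := by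
  induction k with
  | zero =>
    have : ∀ a : Fin (9 + 0), extremalProj 0 a = a := fun a => by
      ext; simp only [extremalProj]; omega
    rw [this, this]
    rfl
  | succ k ih =>
    have h : ∀ a : Fin (9 + k + 1), extremalProj (k + 1) a =
        extremalProj k (Fin.lastCases (motive := fun _ => Fin (9 + k)) (Fin.castAdd k 8) id a) := by
      intro a
      induction a using Fin.lastCases with
      | last => ext; simp [extremalProj]; omega
      | cast a => ext; simp [extremalProj]
    rw [h a, h b, ← ih]
    rfl

instance (i : Fin 7) : DecidableRel (extremalBase i).Adj := fun a b =>
  decidable_of_iff _ (SimpleGraph.fromRel_adj _ a b).symm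

theorem extremalBase_adj_eight : ∀ (i : Fin 7) (b : Fin 9),
    (extremalBase i).Adj 8 b ↔ b = (0 : Fin 8).castSucc ∨ b = (4 : Fin 8).castSucc := by
  decide

/-- The graph `G` arises from `extremalBase i`, with the 8-cycle placed along `f`, by duplicating
the ninth vertex. -/
structure IsExtremalPlacement (G : SimpleGraph V) (i : Fin 7) (f : Fin 8 → V) : Prop where
  injective : f.Injective
  adj_cycle : ∀ a b, G.Adj (f a) (f b) ↔ (extremalBase i).Adj a.castSucc b.castSucc
  adj_outside : ∀ x, x ∉ Set.range f → ∀ y, G.Adj x y ↔ y = f 0 ∨ y = f 4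

open Classical in
/-- The vertex of `extremalBase i` of which `x` is a copy. -/
noncomputable def placementProj (f : Fin 8 → V) (x : V) : Fin 9 :=
  if h : ∃ a, f a = x then h.choose.castSucc else 8

theorem placementProj_apply {f : Fin 8 → V} (hf : f.Injective) (a : Fin 8) :
    placementProj f (f a) = a.castSucc := by
  have h : ∃ b, f b = f a := ⟨a, rfl⟩
  rw [placementProj, dif_pos h, hf h.choose_spec]

theorem placementProj_outside {f : Fin 8 → V} {x : V} (hx : x ∉ Set.range f) :
    placementProj f x = 8 := dif_neg hx

theorem placementProj_eq_castSucc {f : Fin 8 → V} (hf : f.Injective) {a : Fin 8} {x : V} :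
    placementProj f x = a.castSucc ↔ x = f a := by
  refine ⟨fun h => ?_, fun h => h ▸ placementProj_apply hf a⟩
  by_cases hx : x ∈ Set.range f
  · obtain ⟨b, rfl⟩ := hx
    rw [placementProj_apply hf] at h
    rw [Fin.castSucc_injective _ h]
  · rw [placementProj_outside hx] at h
    exact absurd h.symm (Fin.castSucc_lt_last a).ne

theorem IsExtremalPlacement.adj_iff {i : Fin 7} {f : Fin 8 → V} (h : G.IsExtremalPlacement i f)
    (x y : V) :
    G.Adj x y ↔ (extremalBase i).Adj (placementProj f x) (placementProj f y) := by
  have key : ∀ x, x ∉ Set.range f → ∀ y,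
      (G.Adj x y ↔ (extremalBase i).Adj (placementProj f x) (placementProj f y)) := by
    intro x hx y
    rw [h.adj_outside x hx, placementProj_outside hx, extremalBase_adj_eight, placementProj_eq_castSucc h.injective,
      placementProj_eq_castSucc h.injective]
  by_cases hx : x ∈ Set.range f
  · by_cases hy : y ∈ Set.range f
    · obtain ⟨a, rfl⟩ := hx
      obtain ⟨b, rfl⟩ := hy
      rw [placementProj_apply h.injective, placementProj_apply h.injective, h.adj_cycle]
    · rw [G.adj_comm, key y hy x, adj_comm]
  · exact key x hx y

/-- The total count determines the size of the last fibre. -/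
theorem card_fiber_eq {α β : Type*} [Fintype α] [Fintype β] {m : ℕ} (p : α → Fin (m + 1))
    (q : β → Fin (m + 1)) (hcard : Fintype.card α = Fintype.card β)
    (h : ∀ c : Fin m, Fintype.card {x // p x = c.castSucc} = Fintype.card {x // q x = c.castSucc})
    (c : Fin (m + 1)) : Fintype.card {x // p x = c} = Fintype.card {x // q x = c} := by
  have hp := Fintype.card_congr (Equiv.sigmaFiberEquiv p)
  have hq := Fintype.card_congr (Equiv.sigmaFiberEquiv q)
  rw [Fintype.card_sigma, Fin.sum_univ_castSucc] at hp hq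
  induction c using Fin.lastCases with
  | cast c => exact h c
  | last =>
    rw [Finset.sum_congr rfl fun c _ => h c] at hp
    omega

/-- Both graphs are pullbacks of `extremalBase i`, so any bijection that respects the fibres is an
isomorphism. The fibres over the 8-cycle are single points, and counting settles the fibre over 8.
-/
theorem IsExtremalPlacement.nonempty_iso [Fintype V] {i : Fin 7} {f : Fin 8 → V}
    (h : G.IsExtremalPlacement i f) {k : ℕ} (hk : Fintype.card V = 9 + k) :
    Nonempty (G ≃g extremalGraph i k) := by
  classical
  have hfib : ∀ c, Nonempty ({x // placementProj f x = c} ≃ {a // extremalProj k a = c}) := by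
    intro c
    rw [← Fintype.card_eq]
    refine card_fiber_eq _ _ (by simpa using hk) (fun c => ?_) c
    have h1 : Fintype.card {x // placementProj f x = c.castSucc} = 1 :=
      Fintype.card_eq_one_iff.2 ⟨⟨f c, placementProj_apply h.injective c⟩, fun x =>
        Subtype.ext ((placementProj_eq_castSucc h.injective).1 x.2)⟩
    have h2 : Fintype.card {a // extremalProj k a = c.castSucc} = 1 := by
      refine Fintype.card_eq_one_iff.2 ⟨⟨⟨c, by omega⟩, ?_⟩, fun a => ?_⟩
      · ext; simp [extremalProj]
      · have := congrArg Fin.val a.2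
        simp only [extremalProj, Fin.val_castSucc] at this
        ext
        simp only
        omega
    rw [h1, h2]
  refine ⟨⟨Equiv.ofFiberEquiv fun c => (hfib c).some, fun {x y} => ?_⟩⟩
  rw [extremalGraph_adj, Equiv.ofFiberEquiv_map (f := placementProj f) (g := extremalProj k),
    Equiv.ofFiberEquiv_map (f := placementProj f) (g := extremalProj k), h.adj_iff]

theorem exists_isExtremalPlacement {i : Fin 7} {k : ℕ} (e : G ≃g extremalGraph i k) :
    ∃ f, G.IsExtremalPlacement i f := by
  have hadj : ∀ x y, G.Adj x y ↔
      (extremalBase i).Adj (extremalProj k (e x)) (extremalProj k (e y)) := fun x y => by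
    rw [← e.map_adj_iff, extremalGraph_adj]
  have hp : ∀ (a : Fin 8) (x : V), extremalProj k (e x) = a.castSucc ↔
      x = e.symm ⟨a, by omega⟩ := by
    intro a x
    rw [← e.injective.eq_iff, e.apply_symm_apply, Fin.ext_iff, Fin.ext_iff]
    simp only [extremalProj, Fin.val_castSucc]
    omega
  refine ⟨fun a => e.symm ⟨a, by omega⟩, fun a b h => ?_, fun a b => ?_, fun x hx y => ?_⟩
  · have := e.symm.injective h
    ext
    simpa using this
  · rw [hadj, (hp a _).2 rfl, (hp b _).2 rfl]
  · have hx8 : extremalProj k (e x) = 8 := by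
      have : ∀ a : Fin 8, extremalProj k (e x) ≠ a.castSucc := fun a ha =>
        hx ⟨a, ((hp a x).1 ha).symm⟩
      generalize extremalProj k (e x) = c at this ⊢
      revert c; decide
    rw [hadj, hx8, extremalBase_adj_eight, hp, hp]

/-! ### Longest cycles of the extremal graphs. -/

theorem mem_of_isChain {T : Set V} {L : List V} (hL : ∀ a ∈ T, ∀ b ∈ L, G.Adj a b → b ∈ T) {y : V}
    (hy : y ∈ T) (hch : (y :: L).IsChain G.Adj) : ∀ z ∈ L, z ∈ T := by
  induction L generalizing y with
  | nil => simp
  | cons c L ih =>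
    have hc := hL y hy c (by simp) hch.rel
    intro z hz
    rcases List.mem_cons.1 hz with rfl | hz
    · exact hc
    · exact ih (fun a ha b hb => hL a ha b (by simp [hb])) hc hch.of_cons z hz

/-- The neighbours of `x` on the cycle are `f 0` and `f 4`. The remaining path `M` avoids both, so
it stays in one component of their complement: one of the two sides of the 8-cycle, or a single
outside vertex. -/
theorem IsExtremalPlacement.length_le {i : Fin 7} {f : Fin 8 → V} (h : G.IsExtremalPlacement i f)
    {C : List V} (hC : G.IsCycleList C) {x : V} (hx : x ∈ C) (hxf : x ∉ Set.range f) :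
    C.length ≤ 6 := by
  classical
  obtain ⟨C₁, C₂, rfl⟩ := List.append_of_mem hx
  have hr : (C₁ ++ x :: C₂) ~r (x :: (C₂ ++ C₁)) := by
    simpa using List.isRotated_append (l := C₁) (l' := x :: C₂)
  rw [hr.perm.length_eq]
  replace hC := hC.isRotated hr
  generalize C₂ ++ C₁ = l at hC
  rw [isCycleList_cons] at hC
  obtain ⟨h2, hnd, hch⟩ := hC
  obtain ⟨u, l, rfl⟩ : ∃ u t, l = u :: t := List.exists_cons_of_length_pos (by omega)
  obtain ⟨M, w, rfl⟩ : ∃ M w, l = M ++ [w] := by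
    have : l ≠ [] := by rintro rfl; simp at h2
    exact ⟨_, _, (List.dropLast_append_getLast this).symm⟩
  have hu : G.Adj x u := hch.rel
  have hM : (M ++ [w]).IsChain G.Adj := by
    have e : x :: (u :: (M ++ [w]) ++ [x]) = [x, u] ++ ((M ++ [w]) ++ [x]) := by simp
    rw [e] at hch
    exact hch.right_of_append.left_of_append
  have hw : G.Adj w x := by
    have e : x :: (u :: (M ++ [w]) ++ [x]) = (x :: u :: M) ++ [w, x] := by simp
    rw [e] at hch
    exact hch.right_of_append.rel
  rw [h.adj_outside x hxf] at hu
  rw [G.adj_comm, h.adj_outside x hxf] at hw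
  have hav : ∀ z ∈ M, z ≠ f 0 ∧ z ≠ f 4 := by
    clear hch hM
    simp only [List.nodup_append, List.nodup_cons, List.mem_append, List.mem_cons] at hnd
    grind
  have hMnd : M.Nodup := by
    have := hnd.of_cons.of_cons
    exact this.of_append_left
  suffices M.length ≤ 3 by simp; omega
  obtain _ | ⟨y, L⟩ := M
  · simp
  have hyL : (y :: L).IsChain G.Adj := hM.left_of_append
  -- The hypothesis says that `a`, `b`, `c` have no neighbours beyond each other and the pair; in
  -- particular none is adjacent to 8.
  have side : ∀ a b c : Fin 8, (∀ d ∈ [a, b, c], ∀ d' : Fin 9,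
      (extremalBase i).Adj d.castSucc d' → d' = (0 : Fin 8).castSucc ∨ d' = (4 : Fin 8).castSucc ∨
        d' = a.castSucc ∨ d' = b.castSucc ∨ d' = c.castSucc) →
      y ∈ [f a, f b, f c] → (y :: L).length ≤ 3 := by
    intro a b c hcl hy
    have hsub : ∀ z ∈ L, z ∈ {z | z ∈ [f a, f b, f c]} := by
      refine mem_of_isChain (fun s hs t ht hst => ?_) hy hyL
      have ht' := hav t (by simp [ht])
      obtain ⟨d, hd, rfl⟩ : ∃ d ∈ [a, b, c], f d = s := by simpa [eq_comm] using hs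
      rw [h.adj_iff, placementProj_apply h.injective] at hst
      have := hcl d hd _ hst
      simp only [placementProj_eq_castSucc h.injective] at this
      simp
      tauto
    have : (y :: L) ⊆ [f a, f b, f c] := by
      intro z hz
      rcases List.mem_cons.1 hz with rfl | hz
      · exact hy
      · exact hsub z hz
    exact (hMnd.subperm this).length_le
  by_cases hy : y ∈ Set.range f
  · obtain ⟨a, rfl⟩ := hy
    have h04 := hav (f a) (by simp)
    have hcases : a ∈ [1, 2, 3] ∨ a ∈ [5, 6, 7] := by
      have h0 : a ≠ 0 := fun h => h04.1 (h ▸ rfl)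
      have h4 : a ≠ 4 := fun h => h04.2 (h ▸ rfl)
      clear * - h0 h4
      revert a; decide
    rcases hcases with ha | ha
    · refine side 1 2 3 ?_ (by simpa using List.mem_map_of_mem (f := f) ha)
      clear * -; revert i; decide
    · refine side 5 6 7 ?_ (by simpa using List.mem_map_of_mem (f := f) ha)
      clear * -; revert i; decide
  · obtain _ | ⟨z, L⟩ := L
    · simp
    · have := hav z (by simp)
      have := (h.adj_outside y hy z).1 hyL.rel
      tauto

theorem isCycleList_ofFn {f : Fin 8 → V} (hf : f.Injective) (h : ∀ a, G.Adj (f a) (f (a + 1))) :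
    G.IsCycleList (List.ofFn f) := by
  refine ⟨by simp, List.nodup_ofFn.2 hf, ?_⟩
  have e : List.ofFn f = [f 0, f 1, f 2, f 3, f 4, f 5, f 6, f 7] := by simp [List.ofFn_succ]
  rw [e, Cycle.chain_coe_cons]
  simpa using ⟨h 0, h 1, h 2, h 3, h 4, h 5, h 6, h 7⟩

theorem IsExtremalPlacement.cummerbundCoveringNumber_le {i : Fin 7} {f : Fin 8 → V}
    (h : G.IsExtremalPlacement i f) : G.cummerbundCoveringNumber ≤ 8 := by
  have hcyc : G.IsCycleList (List.ofFn f) := isCycleList_ofFn h.injective fun a => by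
    rw [h.adj_cycle]
    clear h; revert i a; decide
  rw [cummerbundCoveringNumber_eq]
  have hsub : {x : V | ∃ l, G.IsCummerbundList l ∧ x ∈ l} ⊆ Set.range f := by
    rintro x ⟨l, hl, hx⟩
    by_contra hxf
    have h1 := h.length_le hl.1 hx hxf
    have h2 := hl.2 _ hcyc
    simp at h2
    omega
  refine (Set.ncard_le_ncard hsub (Set.finite_range f)).trans ?_
  rw [← Set.image_univ]
  exact (Set.ncard_image_le Set.finite_univ).trans (by simp [Set.ncard_univ])

/-! ### Structure around an 8-cycle when exactly 8 vertices are covered. -/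

/-- An 8-cycle along `f` such that every cycle of length at least 8 stays on it, and such that every
ear of it has a single inner vertex and antipodal ends. -/
structure IsTightCycle (G : SimpleGraph V) (f : Fin 8 → V) : Prop where
  injective : f.Injective
  adj_succ : ∀ a, G.Adj (f a) (f (a + 1))
  mem_range : ∀ l, G.IsCycleList l → 8 ≤ l.length → ∀ x ∈ l, x ∈ Set.range f
  ear : ∀ a l b, G.IsEar (Set.range f) a l b → l ≠ [] →
    l.length = 1 ∧ ∃ i, a = f i ∧ b = f (i + 4)

theorem exists_isTightCycle [Fintype V] (h : G.IsKConnected 2) (hG : G.IsBipartite)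
    (hcard : 9 ≤ Fintype.card V) (h8 : G.cummerbundCoveringNumber = 8) :
    ∃ f, G.IsTightCycle f := by
  classical
  obtain ⟨C, hC⟩ := h.exists_isCummerbundList
  have hlen : C.length = 8 := by
    have hle := hC.length_le_cummerbundCoveringNumber
    by_contra hne
    have := hC.cummerbundCoveringNumber_of_length_lt h hG (by omega)
    omega
  obtain ⟨f, rfl⟩ : ∃ f : Fin 8 → V, C = List.ofFn f :=
    ⟨fun i => C[i], List.ext_getElem (hlen.trans List.length_ofFn.symm)
      fun _ _ _ => by rw [List.getElem_ofFn]; rfl⟩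
  have hmem : ∀ x, x ∈ List.ofFn f ↔ x ∈ Set.range f := fun x => by
    rw [List.mem_ofFn']
  -- The 8 vertices of `C` are covered and only 8 vertices are, so no longest cycle leaves `C`.
  have hU : {x | x ∈ List.ofFn f} = {x : V | ∃ l, G.IsCummerbundList l ∧ x ∈ l} := by
    refine Set.eq_of_subset_of_ncard_le (fun x hx => ⟨_, hC, hx⟩) ?_ (Set.toFinite _)
    have hn := List.toFinset_card_of_nodup hC.1.2.1
    rw [hlen, ← Set.ncard_coe_finset, List.coe_toFinset] at hn
    rw [← cummerbundCoveringNumber_eq, h8, hn]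
  have hsub : ∀ l, G.IsCummerbundList l → ∀ x ∈ l, x ∈ List.ofFn f := fun l hl x hx => by
    have : x ∈ {x : V | ∃ l, G.IsCummerbundList l ∧ x ∈ l} := ⟨l, hl, hx⟩
    rwa [← hU] at this
  have hch := hC.1.2.2
  have e : List.ofFn f = [f 0, f 1, f 2, f 3, f 4, f 5, f 6, f 7] := by simp [List.ofFn_succ]
  rw [e, Cycle.chain_coe_cons] at hch
  simp only [List.cons_append, List.nil_append, List.isChain_cons_cons, List.isChain_singleton,
    and_true] at hch
  obtain ⟨h0, h1, h2, h3, h4, h5, h6, h7⟩ := hch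
  refine ⟨f, List.nodup_ofFn.1 hC.1.2.1, ?_, fun l hl hl8 x hx => ?_, fun a l b he hl => ?_⟩
  · intro a
    fin_cases a
    exacts [h0, h1, h2, h3, h4, h5, h6, h7]
  · exact (hmem x).1 (hsub l ⟨hl, fun m hm => (hC.2 m hm).trans (by omega)⟩ x hx)
  · have he' : G.IsEar {x | x ∈ List.ofFn f} a l b := by
      convert he using 1
      ext x; exact hmem x
    obtain ⟨A, B, hr, hAB, hev, hA, hB, hpar, hcov⟩ := hC.arcs_of_isEar hG he' hl
    have hpos := List.length_pos_iff.2 hl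
    have hne : ¬ (l.length = A.length ∨ l.length = B.length) := by
      intro hor
      obtain ⟨y, hy⟩ := List.exists_mem_of_length_pos hpos
      obtain ⟨D, hD, hyD⟩ := hcov hor y hy
      exact he'.2.2.1 y hy (hsub D hD y hyD)
    push Not at hne
    -- The arcs have 6 inner vertices together. An ear shorter than both, of their parity, leaves
    -- only this case.
    have hl1 : l.length = 1 ∧ A.length = 3 := by omega
    refine ⟨hl1.1, ?_⟩
    -- In the rotated list `a` is at position 0 and `b` at position 4, so their indices on `f`
    -- differ by 4.
    obtain ⟨n, hn⟩ := hr
    have ha : a = f ⟨n % 8, by omega⟩ := by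
      have : (a :: (A ++ b :: B))[0]? = some a := by simp
      rw [← hn, List.getElem?_rotate (by simp)] at this
      rw [List.length_ofFn, zero_add, List.getElem?_ofFn, dif_pos (Nat.mod_lt _ (by omega))] at this
      exact (Option.some_inj.1 this).symm
    have hb : b = f ⟨(4 + n) % 8, by omega⟩ := by
      have : (a :: (A ++ b :: B))[4]? = some b := by simp [hl1.2]
      rw [← hn, List.getElem?_rotate (by simp)] at this
      rw [List.length_ofFn, List.getElem?_ofFn, dif_pos (Nat.mod_lt _ (by omega))] at this
      exact (Option.some_inj.1 this).symm
    refine ⟨⟨n % 8, by omega⟩, ha, hb.trans (congrArg f ?_)⟩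
    ext
    simp [Fin.val_add]
    omega

namespace IsTightCycle

variable {f : Fin 8 → V}

/-- Allows a chosen antipodal pair to be labelled `f 0`, `f 4`. -/
theorem rotate (h : G.IsTightCycle f) (i : Fin 8) : G.IsTightCycle fun a => f (a + i) := by
  have hr : Set.range (fun a => f (a + i)) = Set.range f := by
    ext x
    constructor
    · rintro ⟨a, rfl⟩
      exact ⟨_, rfl⟩
    · rintro ⟨a, rfl⟩
      exact ⟨a - i, by simp⟩
  refine ⟨fun a b hab => ?_, fun a => ?_, ?_, ?_⟩
  · exact add_right_cancel (h.injective hab)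
  · have := h.adj_succ (a + i)
    rwa [add_right_comm] at this
  · rw [hr]; exact h.mem_range
  · rw [hr]
    intro a l b he hl
    obtain ⟨h1, j, rfl, rfl⟩ := h.ear a l b he hl
    exact ⟨h1, j - i, by simp, congrArg f (by abel)⟩

theorem range_nontrivial (h : G.IsTightCycle f) : (Set.range f).Nontrivial :=
  ⟨f 0, ⟨0, rfl⟩, f 1, ⟨1, rfl⟩, (h.adj_succ 0).ne⟩

/-- The neighbourhood of a vertex outside a tight cycle is a pair of antipodal vertices. -/
theorem exists_adj_iff [Fintype V] (h : G.IsTightCycle f) (hk : G.IsKConnected 2) {x : V}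
    (hx : x ∉ Set.range f) : ∃ i, ∀ y, G.Adj x y ↔ y = f i ∨ y = f (i + 4) := by
  have hanti : ∀ x, x ∉ Set.range f → ∃ i, G.Adj x (f i) ∧ G.Adj x (f (i + 4)) := by
    intro x hx
    obtain ⟨a, l, b, he, hxl⟩ := exists_isEar hk.connected_induce_compl_singleton
      hk.connected.preconnected h.range_nontrivial hx
    obtain ⟨h1, i, rfl, rfl⟩ := h.ear a l b he (List.ne_nil_of_mem hxl)
    obtain ⟨y, rfl⟩ := List.length_eq_one_iff.1 h1
    obtain rfl := List.mem_singleton.1 hxl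
    have := he.2.2.2.2
    simp only [List.cons_append, List.nil_append, List.isChain_cons_cons, List.isChain_singleton,
      and_true] at this
    exact ⟨i, this.1.symm, this.2⟩
  have hne : ∀ {x j}, x ∉ Set.range f → x ≠ f j := fun hx he => hx ⟨_, he.symm⟩
  obtain ⟨i, h1, h2⟩ := hanti x hx
  have hii : i ≠ i + 4 := by clear h1 h2; revert i; decide
  refine ⟨i, fun y => ⟨fun hxy => ?_, ?_⟩⟩
  · by_cases hy : y ∈ Set.range f
    · obtain ⟨k, rfl⟩ := hy
      by_cases hki : k = i
      · exact .inl (hki ▸ rfl)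
      -- A further neighbour `f k` makes `x` the inner vertex of an ear from `f i` to `f k`, so `k =
      -- i + 4`.
      · obtain ⟨-, m, hm, hm'⟩ := h.ear (f i) [x] (f k) ⟨⟨i, rfl⟩, ⟨k, rfl⟩, by simpa using hx,
          by simp [(hne hx).symm, hne hx, h.injective.eq_iff, Ne.symm hki],
          by simpa using ⟨h1.symm, hxy⟩⟩ (by simp)
        rw [hm', ← h.injective hm]
        exact .inr rfl
    · exfalso
      obtain ⟨j, h3, h4⟩ := hanti y hy
      -- One of the two antipodal neighbours of `y` differs from `f i`, and the path through `x` and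
      -- `y` to it is an ear with two inner vertices.
      obtain ⟨k, hk, hyk⟩ : ∃ k, k ≠ i ∧ G.Adj y (f k) := by
        by_cases hj : j = i
        · exact ⟨j + 4, by rw [hj]; exact hii.symm, h4⟩
        · exact ⟨j, hj, h3⟩
      have := (h.ear (f i) [x, y] (f k) ⟨⟨i, rfl⟩, ⟨k, rfl⟩, by
            simpa using ⟨by simpa using hx, by simpa using hy⟩,
          by simp [(hne hx).symm, (hne hy).symm, hne hx, hne hy, h.injective.eq_iff, Ne.symm hk,
            hxy.ne],
          by simpa using ⟨h1.symm, hxy, hyk⟩⟩ (by simp)).1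
      simp at this
  · rintro (rfl | rfl)
    exacts [h1, h2]

/-- A cycle of length at least 8 through a vertex outside a tight cycle is impossible. -/
theorem not_isCycleList (h : G.IsTightCycle f) {x : V} (hx : x ∉ Set.range f) {l : List V}
    (hl : 8 ≤ l.length) (hxl : x ∈ l) : ¬ G.IsCycleList l :=
  fun hc => hx (h.mem_range l hc hl x hxl)

/-- If `y` were attached to another antipodal pair, a cycle of length 8 or 10 would pass through
both `x` and `y`. Up to swapping the ends there are three such pairs. -/
theorem adj_outside [Fintype V] (h : G.IsTightCycle f) (hk : G.IsKConnected 2) {x : V}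
    (hx : x ∉ Set.range f) (hxf : ∀ y, G.Adj x y ↔ y = f 0 ∨ y = f 4) {y : V}
    (hy : y ∉ Set.range f) (z : V) : G.Adj y z ↔ z = f 0 ∨ z = f 4 := by
  have hne : ∀ {x}, x ∉ Set.range f → ∀ j, x ≠ f j := fun hx j he => hx ⟨_, he.symm⟩
  have hx' := hne hx
  have hy' := hne hy
  have hx'' := fun j => (hx' j).symm
  have hy'' := fun j => (hy' j).symm
  have a0 : G.Adj (f 0) (f 1) := h.adj_succ 0
  have a1 : G.Adj (f 1) (f 2) := h.adj_succ 1
  have a2 : G.Adj (f 2) (f 3) := h.adj_succ 2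
  have a3 : G.Adj (f 3) (f 4) := h.adj_succ 3
  have a4 : G.Adj (f 4) (f 5) := h.adj_succ 4
  have a5 : G.Adj (f 5) (f 6) := h.adj_succ 5
  have a6 : G.Adj (f 6) (f 7) := h.adj_succ 6
  have a7 : G.Adj (f 7) (f 0) := h.adj_succ 7
  have x0 := (hxf _).2 (.inl rfl)
  have x4 := (hxf _).2 (.inr rfl)
  obtain ⟨i, hi⟩ := h.exists_adj_iff hk hy
  have hxy : ∀ j, ¬ (j = 0 ∨ j = 4) → G.Adj y (f j) → x ≠ y := by
    rintro j hj hyj rfl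
    rw [hxf, h.injective.eq_iff, h.injective.eq_iff] at hyj
    exact hj hyj
  have c1 : G.Adj y (f 1) → G.Adj y (f 5) → False := fun y1 y5 => by
    have := hxy 1 (by decide) y1
    refine h.not_isCycleList hx (l := [f 0, x, f 4, f 3, f 2, f 1, y, f 5, f 6, f 7]) (by simp)
      (by simp) (isCycleList_cons.2 ⟨by simp, ?_, ?_⟩)
    · simp [h.injective.eq_iff, hx', hy', hx'', hy'', this]
    · simp [x0.symm, x4, a3.symm, a2.symm, a1.symm, y1.symm, y5, a5, a6, a7]
  have c2 : G.Adj y (f 2) → G.Adj y (f 6) → False := fun y2 y6 => by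
    have := hxy 2 (by decide) y2
    refine h.not_isCycleList hx (l := [f 0, x, f 4, f 3, f 2, y, f 6, f 7]) (by simp)
      (by simp) (isCycleList_cons.2 ⟨by simp, ?_, ?_⟩)
    · simp [h.injective.eq_iff, hx', hy', hx'', hy'', this]
    · simp [x0.symm, x4, a3.symm, a2.symm, y2.symm, y6, a6, a7]
  have c3 : G.Adj y (f 3) → G.Adj y (f 7) → False := fun y3 y7 => by
    have := hxy 3 (by decide) y3
    refine h.not_isCycleList hx (l := [f 0, x, f 4, f 5, f 6, f 7, y, f 3, f 2, f 1]) (by simp)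
      (by simp) (isCycleList_cons.2 ⟨by simp, ?_, ?_⟩)
    · simp [h.injective.eq_iff, hx', hy', hx'', hy'', this]
    · simp [x0.symm, x4, a4, a5, a6, y7.symm, y3, a2.symm, a1.symm, a0.symm]
  have hi1 := (hi _).2 (.inl rfl)
  have hi2 := (hi _).2 (.inr rfl)
  rw [hi]
  fin_cases i
  · rfl
  · exact (c1 hi1 hi2).elim
  · exact (c2 hi1 hi2).elim
  · exact (c3 hi1 hi2).elim
  · exact or_comm
  · exact (c1 hi2 hi1).elim
  · exact (c2 hi2 hi1).elim
  · exact (c3 hi2 hi1).elim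

/-- The bipartite chords of a tight cycle all have an end in `f 0` or `f 4`. -/
theorem not_adj (h : G.IsTightCycle f) {x : V} (hx : x ∉ Set.range f)
    (x0 : G.Adj x (f 0)) (x4 : G.Adj x (f 4)) :
    ¬ G.Adj (f 1) (f 6) ∧ ¬ G.Adj (f 2) (f 5) ∧ ¬ G.Adj (f 2) (f 7) ∧ ¬ G.Adj (f 3) (f 6) := by
  have hx' : ∀ j, x ≠ f j := fun j he => hx ⟨_, he.symm⟩
  have hx'' := fun j => (hx' j).symm
  have a0 : G.Adj (f 0) (f 1) := h.adj_succ 0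
  have a1 : G.Adj (f 1) (f 2) := h.adj_succ 1
  have a2 : G.Adj (f 2) (f 3) := h.adj_succ 2
  have a3 : G.Adj (f 3) (f 4) := h.adj_succ 3
  have a4 : G.Adj (f 4) (f 5) := h.adj_succ 4
  have a5 : G.Adj (f 5) (f 6) := h.adj_succ 5
  have a6 : G.Adj (f 6) (f 7) := h.adj_succ 6
  have a7 : G.Adj (f 7) (f 0) := h.adj_succ 7
  -- Each of these chords gives an 8-cycle through `x` that misses just one vertex of the tight
  -- cycle.
  refine ⟨fun hc => ?_, fun hc => ?_, fun hc => ?_, fun hc => ?_⟩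
  · refine h.not_isCycleList hx (l := [f 0, f 7, f 6, f 1, f 2, f 3, f 4, x]) (by simp) (by simp)
      (isCycleList_cons.2 ⟨by simp, by simp [h.injective.eq_iff, hx''], ?_⟩)
    simp [a7.symm, a6.symm, hc.symm, a1, a2, a3, x4.symm, x0]
  · refine h.not_isCycleList hx (l := [f 0, f 7, f 6, f 5, f 2, f 3, f 4, x]) (by simp) (by simp)
      (isCycleList_cons.2 ⟨by simp, by simp [h.injective.eq_iff, hx''], ?_⟩)
    simp [a7.symm, a6.symm, a5.symm, hc.symm, a2, a3, x4.symm, x0]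
  · refine h.not_isCycleList hx (l := [f 0, f 1, f 2, f 7, f 6, f 5, f 4, x]) (by simp) (by simp)
      (isCycleList_cons.2 ⟨by simp, by simp [h.injective.eq_iff, hx''], ?_⟩)
    simp [a0, a1, hc, a6.symm, a5.symm, a4.symm, x4.symm, x0]
  · refine h.not_isCycleList hx (l := [f 0, f 1, f 2, f 3, f 6, f 5, f 4, x]) (by simp) (by simp)
      (isCycleList_cons.2 ⟨by simp, by simp [h.injective.eq_iff, hx''], ?_⟩)
    simp [a0, a1, a2, hc, a5.symm, a4.symm, x4.symm, x0]

end IsTightCycle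

/-! ### Chords and the classification. -/

/-- The directed edges of an 8-cycle with those of the chords `0 3`, `0 5`, `1 4`, `4 7` that
are switched on by the Booleans `p`, `q`, `r`, `s`. -/
def chordRel (p q r s : Bool) (a b : Fin 8) : Bool :=
  b == a + 1 || (p && a == 0 && b == 3) || (q && a == 0 && b == 5) || (r && a == 1 && b == 4) ||
    (s && a == 4 && b == 7)

/-- Up to one of the four symmetries of the 8-cycle that preserve `{0, 4}`, every set of these
chords is one of the seven listed in `extremalChords`. -/
theorem exists_extremalBase : ∀ p q r s : Bool, ∃ (i : Fin 7) (u t : Fin 8),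
    ((u = 1 ∨ u = -1) ∧ (t = 0 ∨ t = 4)) ∧
    ∀ a b : Fin 8, (extremalBase i).Adj a.castSucc b.castSucc ↔
      (chordRel p q r s (u * a + t) (u * b + t) || chordRel p q r s (u * b + t) (u * a + t)) := by
  decide

/-- The colours alternate along the cycle, so a chord joins indices of opposite parity. There are
eight such chords, and `IsTightCycle.not_adj` removes four. -/
theorem IsTightCycle.adj_iff {f : Fin 8 → V} (h : G.IsTightCycle f) (hG : G.IsBipartite) {x : V}
    (hx : x ∉ Set.range f) (x0 : G.Adj x (f 0)) (x4 : G.Adj x (f 4)) :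
    ∃ p q r s : Bool, ∀ a b, G.Adj (f a) (f b) ↔
      (chordRel p q r s a b || chordRel p q r s b a) := by
  classical
  obtain ⟨h16, h25, h27, h36⟩ := h.not_adj hx x0 x4
  obtain ⟨col⟩ := hG
  have hcol : ∀ a b, G.Adj (f a) (f b) → (a : ℕ) % 2 ≠ (b : ℕ) % 2 := by
    have step : ∀ a, col (f a) ≠ col (f (a + 1)) := fun a => col.valid (h.adj_succ a)
    have hval : ∀ a, (col (f a) : ℕ) = (col (f 0) + a) % 2 := by
      have s0 : col (f 0) ≠ col (f 1) := step 0
      have s1 : col (f 1) ≠ col (f 2) := step 1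
      have s2 : col (f 2) ≠ col (f 3) := step 2
      have s3 : col (f 3) ≠ col (f 4) := step 3
      have s4 : col (f 4) ≠ col (f 5) := step 4
      have s5 : col (f 5) ≠ col (f 6) := step 5
      have s6 : col (f 6) ≠ col (f 7) := step 6
      intro a
      fin_cases a <;> simp <;> omega
    intro a b hab hmod
    have hne := col.valid hab
    rw [ne_eq, Fin.ext_iff, hval a, hval b] at hne
    omega
  refine ⟨G.Adj (f 0) (f 3), G.Adj (f 0) (f 5), G.Adj (f 1) (f 4), G.Adj (f 4) (f 7),
    fun a b => ⟨fun hab => ?_, fun hab => ?_⟩⟩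
  · have hlist : ∀ a b : Fin 8, (a : ℕ) % 2 ≠ (b : ℕ) % 2 → b = a + 1 ∨ a = b + 1 ∨
        (a, b) ∈ [((0 : Fin 8), (3 : Fin 8)), (0, 5), (1, 4), (4, 7), (1, 6), (2, 5), (2, 7),
          (3, 6)] ∨
        (b, a) ∈ [((0 : Fin 8), (3 : Fin 8)), (0, 5), (1, 4), (4, 7), (1, 6), (2, 5), (2, 7),
          (3, 6)] := by
      decide
    have := hlist a b (hcol a b hab)
    simp only [List.mem_cons, Prod.mk.injEq, List.not_mem_nil, or_false] at this
    have hba := hab.symm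
    rcases this with rfl | rfl | this | this
    · simp [chordRel]
    · simp [chordRel]
    all_goals
      rcases this with ⟨rfl, rfl⟩ | ⟨rfl, rfl⟩ | ⟨rfl, rfl⟩ | ⟨rfl, rfl⟩ | ⟨rfl, rfl⟩ | ⟨rfl, rfl⟩ |
        ⟨rfl, rfl⟩ | ⟨rfl, rfl⟩ <;>
      first
        | contradiction
        | simp [chordRel, hab, hba]
  · have hsymm : ∀ a b : Fin 8, chordRel (G.Adj (f 0) (f 3)) (G.Adj (f 0) (f 5))
        (G.Adj (f 1) (f 4)) (G.Adj (f 4) (f 7)) a b → G.Adj (f a) (f b) := by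
      intro a b hab
      simp only [chordRel, Bool.or_eq_true, Bool.and_eq_true, beq_iff_eq, decide_eq_true_eq] at hab
      rcases hab with (((rfl | ⟨⟨hc, rfl⟩, rfl⟩) | ⟨⟨hc, rfl⟩, rfl⟩) | ⟨⟨hc, rfl⟩, rfl⟩) |
        ⟨⟨hc, rfl⟩, rfl⟩
      · exact h.adj_succ a
      all_goals exact hc
    rw [Bool.or_eq_true] at hab
    exact hab.elim (hsymm a b) fun hba => (hsymm b a hba).symm

theorem exists_isExtremalPlacement_of_cummerbundCoveringNumber_eq [Fintype V]
    (hk : G.IsKConnected 2) (hG : G.IsBipartite) (hcard : 9 ≤ Fintype.card V)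
    (h8 : G.cummerbundCoveringNumber = 8) : ∃ i f, G.IsExtremalPlacement i f := by
  classical
  obtain ⟨f₀, h₀⟩ := exists_isTightCycle hk hG hcard h8
  obtain ⟨x, hx₀⟩ : ∃ x, x ∉ Set.range f₀ := by
    by_contra! hall
    have := Fintype.card_le_of_surjective f₀ hall
    simp at this
    omega
  obtain ⟨j, hj⟩ := h₀.exists_adj_iff hk hx₀
  obtain ⟨f, h, hx, hxf⟩ : ∃ f, G.IsTightCycle f ∧ x ∉ Set.range f ∧
      ∀ y, G.Adj x y ↔ y = f 0 ∨ y = f 4 :=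
    ⟨fun a => f₀ (a + j), h₀.rotate j, fun ⟨a, ha⟩ => hx₀ ⟨_, ha⟩, fun y => by
      simp only [hj, zero_add, add_comm j]⟩
  obtain ⟨p, q, r, s, hadj⟩ := h.adj_iff hG hx ((hxf _).2 (.inl rfl)) ((hxf _).2 (.inr rfl))
  obtain ⟨i, u, t, hut, hi⟩ := exists_extremalBase p q r s
  -- The maps `a ↦ u * a + t` are permutations of the 8-cycle that fix or swap 0 and 4, so outside
  -- vertices keep their neighbourhood.
  have hinj : ∀ u t : Fin 8, ((u = 1 ∨ u = -1) ∧ (t = 0 ∨ t = 4)) →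
      (∀ a b : Fin 8, u * a + t = u * b + t → a = b) ∧ (∀ a : Fin 8, ∃ b, u * b + t = a) ∧
        ((u * 0 + t = 0 ∧ u * 4 + t = 4) ∨ (u * 0 + t = 4 ∧ u * 4 + t = 0)) := by
    decide
  obtain ⟨hi1, hi2, hi3⟩ := hinj u t hut
  refine ⟨i, fun a => f (u * a + t), fun a b hab => hi1 a b (h.injective hab),
    fun a b => by rw [hadj, hi], fun y hy z => ?_⟩
  have hy' : y ∉ Set.range f := by
    rintro ⟨a, rfl⟩
    obtain ⟨b, rfl⟩ := hi2 a
    exact hy ⟨b, rfl⟩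
  rw [h.adj_outside hk hx hxf hy']
  rcases hi3 with ⟨e1, e2⟩ | ⟨e1, e2⟩
  · rw [e1, e2]
  · rw [e1, e2, or_comm]

end SimpleGraph

theorem theorem14 {V : Type*} [Fintype V] (G : SimpleGraph V) (n : ℕ) (hn : 9 ≤ n)
    (hcard : Fintype.card V = n) (hconn : G.IsKConnected 2) (hbip : G.IsBipartite) :
    8 ≤ G.cummerbundCoveringNumber ∧
      (G.cummerbundCoveringNumber = 8 ↔
        ∃ i : Fin 7, Nonempty (G ≃g extremalGraph i (n - 9))) := by
  have h8 : 8 ≤ G.cummerbundCoveringNumber := by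
    obtain ⟨C, hC⟩ := hconn.exists_isCummerbundList
    have hle := hC.length_le_cummerbundCoveringNumber
    by_contra hlt
    have := hC.cummerbundCoveringNumber_of_length_lt hconn hbip (by omega)
    omega
  refine ⟨h8, fun h => ?_, ?_⟩
  · obtain ⟨i, f, hf⟩ :=
      SimpleGraph.exists_isExtremalPlacement_of_cummerbundCoveringNumber_eq hconn hbip (by omega) h
    exact ⟨i, hf.nonempty_iso (by omega)⟩
  · rintro ⟨i, ⟨e⟩⟩
    obtain ⟨f, hf⟩ := SimpleGraph.exists_isExtremalPlacement e
    exact le_antisymm hf.cummerbundCoveringNumber_le h8
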